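/- A \emph{convex-polynomial} is an element of the convex hull of the monomials $\{1,x,x^2,x^3,\dots\}$ in the vector space of real polynomials, i.e. a polynomial $\sum_{k=0}^n a_kx^k$ with $a_k\ge 0$ for all $k$ and $\sum_{k=0}^n a_k=1$. For a real open interval $(a,b)$ let $C_b(a,b)$ be the space of bounded continuous functions $f:(a,b)\to\mathbb R$, let $C_0(a,b)$ be the space of continuous functions $\varphi:(a,b)\to\mathbb R$ that vanish at infinity on $(a,b)$ (that is, $\lim_{x\to a^+}\varphi(x)=\lim_{x\to b^-}\varphi(x)=0$), and let the \emph{strict topology} on $C_b(a,b)$ be the locally convex topology given by the seminorms $\|f\|_\varphi=\sup_{x\in(a,b)}|\varphi(x)f(x)|$, $\varphi\in C_0(a,b)$. \textbf{Theorem.} Let $a,b\in\mathbb R$ with $a<b\le -1$. Then the set of (restrictions to $(a,b)$ of) convex-polynomials is dense in $C_b(a,b)$ with the strict topology. -/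

import Mathlib

open scoped BoundedContinuousFunction ZeroAtInfty Polynomial

/-- The set of convex-polynomials: the convex hull of the monomials `1, x, x ^ 2, …` in the real
vector space of all real polynomials. -/
def convexPolynomials : Set ℝ[X] :=
  convexHull ℝ (Set.range fun n : ℕ => (Polynomial.X : ℝ[X]) ^ n)

/-- The supremum defining the weighted seminorms below is always a supremum of a bounded set. -/
theorem bddAbove_range_abs_mul {X : Type*} [TopologicalSpace X] (φ : C₀(X, ℝ)) (f : X →ᵇ ℝ) :
    BddAbove (Set.range fun x => |φ x * f x|) := by
  refine ⟨‖φ.toBCF * f‖, ?_⟩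
  rintro _ ⟨x, rfl⟩
  exact (φ.toBCF * f).norm_coe_le_norm x

/-- The seminorm `f ↦ sup_{x ∈ X} |φ x * f x|` on `C_b(X)`, for a weight `φ ∈ C₀(X)`. -/
noncomputable def strictSeminorm {X : Type*} [TopologicalSpace X] (φ : C₀(X, ℝ)) :
    Seminorm ℝ (X →ᵇ ℝ) :=
  Seminorm.of (fun f => ⨆ x, |φ x * f x|)
    (fun f g => by
      refine Real.iSup_le (fun x => ?_)
        (add_nonneg (Real.iSup_nonneg fun _ => abs_nonneg _)
          (Real.iSup_nonneg fun _ => abs_nonneg _))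
      calc |φ x * (f + g) x| = |φ x * f x + φ x * g x| := by
            rw [BoundedContinuousFunction.add_apply, mul_add]
        _ ≤ |φ x * f x| + |φ x * g x| := abs_add_le _ _
        _ ≤ _ := add_le_add (le_ciSup (bddAbove_range_abs_mul φ f) x)
            (le_ciSup (bddAbove_range_abs_mul φ g) x))
    (fun c f => by
      rw [Real.norm_eq_abs, Real.mul_iSup_of_nonneg (abs_nonneg c)]
      congr 1
      funext x
      rw [BoundedContinuousFunction.smul_apply, smul_eq_mul, ← abs_mul, mul_left_comm])

theorem strictSeminorm_apply {X : Type*} [TopologicalSpace X] (φ : C₀(X, ℝ)) (f : X →ᵇ ℝ) :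
    strictSeminorm φ f = ⨆ x, |φ x * f x| := rfl

/-- Buck's strict topology on `C_b(X)`: the locally convex topology generated by the family of
seminorms `f ↦ sup_{x ∈ X} |φ x * f x|`, where `φ` ranges over `C₀(X)`. -/
@[reducible] noncomputable def strictTopology (X : Type*) [TopologicalSpace X] :
    TopologicalSpace (X →ᵇ ℝ) :=
  (SeminormFamily.moduleFilterBasis (𝕜 := ℝ)
    (fun φ : C₀(X, ℝ) => strictSeminorm φ)).topology

open Filter Topology

/-! Let `K` be the uniform closure of the convex-polynomials in `C[a, -1]`; it is convex and closed
under products. Formally `R_z = (1 - z) / (1 - z x) = (1 - z) ∑ zⁿ xⁿ` is a convex combination of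
monomials. The series diverges for large `|x|`, but `R_z ∈ K` for all `0 ≤ z < 1` by continuation in
`z` (`normalizedResolvent_mem`). Since `x ≤ -1`, `‖R_z‖ ≤ 1 - z`, so `z → 1` gives `0 ∈ K`.

Resolvents also absorb negative coefficients: if `|pₙ| ≤ δ rⁿ` with `r < 1`, adding `δ ∑ rⁿ xⁿ`,
read as `δ / (1 - r x)`, makes every coefficient nonnegative and moves `p` by at most `δ`. Hence `K`
contains every limit of polynomials whose coefficients are small relative to `rⁿ`
(`mem_convexPolynomialClosure_of_mem_smallCoeffLimits`). With `ρ = 1 / r`, such limits form a closed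
ideal containing the ramps `max (-x - τ) 0` for `τ > ρ` (`ramp_mem_smallCoeffLimits`), hence all
functions vanishing near `-1` once `ρ` is close enough to `1`. Strict approximation reduces to this
case by a cutoff near `b`. -/

theorem mem_convexPolynomials_iff {p : ℝ[X]} :
    p ∈ convexPolynomials ↔ (∀ n, 0 ≤ p.coeff n) ∧ p.eval 1 = 1 := by
  constructor
  · intro hp
    have hconv : Convex ℝ {p : ℝ[X] | (∀ n, 0 ≤ p.coeff n) ∧ p.eval 1 = 1} := by
      rintro p ⟨hp, hp1⟩ q ⟨hq, hq1⟩ s t hs ht hst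
      refine ⟨fun n => ?_, ?_⟩
      · simpa using add_nonneg (mul_nonneg hs (hp n)) (mul_nonneg ht (hq n))
      · simp [hp1, hq1, hst]
    refine convexHull_min ?_ hconv hp
    rintro _ ⟨n, rfl⟩
    refine ⟨fun k => ?_, by simp⟩
    rw [Polynomial.coeff_X_pow]
    split_ifs <;> norm_num
  · rintro ⟨hp, hp1⟩
    have key : ∑ i ∈ Finset.range (p.natDegree + 1), p.coeff i • (Polynomial.X : ℝ[X]) ^ i
        ∈ convexPolynomials := by
      refine (convex_convexHull ℝ _).sum_mem (fun i _ => hp i) ?_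
        (fun i _ => subset_convexHull ℝ _ ⟨i, rfl⟩)
      rw [← hp1, Polynomial.eval_eq_sum_range]
      simp
    simp only [Polynomial.smul_eq_C_mul] at key
    rwa [← Polynomial.as_sum_range_C_mul_X_pow] at key

theorem mul_mem_convexPolynomials {p q : ℝ[X]} (hp : p ∈ convexPolynomials)
    (hq : q ∈ convexPolynomials) : p * q ∈ convexPolynomials := by
  rw [mem_convexPolynomials_iff] at *
  refine ⟨fun n => ?_, by simp [hp.2, hq.2]⟩
  rw [Polynomial.coeff_mul]
  exact Finset.sum_nonneg fun i _ => mul_nonneg (hp.1 _) (hq.1 _)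

/-! ### The closure of the convex-polynomials as a convex multiplicative set. -/

section ConvexClosure

variable {A : Type*} [NormedCommRing A] [NormedAlgebra ℝ A]

/-- The closure of the set of values of convex-polynomials at an element of a normed algebra. -/
def convexPolynomialClosure (x : A) : Set A :=
  closure (Polynomial.aeval x '' convexPolynomials)

theorem convex_convexPolynomialClosure (x : A) : Convex ℝ (convexPolynomialClosure x) :=
  ((convex_convexHull ℝ _).linear_image (Polynomial.aeval x).toLinearMap).closure

theorem aeval_mem_convexPolynomialClosure (x : A) {p : ℝ[X]} (hp : p ∈ convexPolynomials) :
    Polynomial.aeval x p ∈ convexPolynomialClosure x :=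
  subset_closure ⟨p, hp, rfl⟩

theorem pow_mem_convexPolynomialClosure (x : A) (n : ℕ) :
    x ^ n ∈ convexPolynomialClosure x := by
  simpa using aeval_mem_convexPolynomialClosure x
    (subset_convexHull ℝ _ ⟨n, rfl⟩ : (Polynomial.X : ℝ[X]) ^ n ∈ convexPolynomials)

theorem mul_mem_convexPolynomialClosure {x y z : A} (hy : y ∈ convexPolynomialClosure x)
    (hz : z ∈ convexPolynomialClosure x) : y * z ∈ convexPolynomialClosure x := by
  refine map_mem_closure₂ continuous_mul hy hz ?_
  rintro _ ⟨p, hp, rfl⟩ _ ⟨q, hq, rfl⟩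
  exact ⟨p * q, mul_mem_convexPolynomials hp hq, map_mul _ _ _⟩

/-- The fixed point of an affine contraction that preserves the closure lies in the closure. -/
theorem mem_convexPolynomialClosure_of_fixedPoint {x g h y : A} {μ : ℝ}
    (hg : g ∈ convexPolynomialClosure x) (hh : h ∈ convexPolynomialClosure x)
    (hμ₀ : 0 ≤ μ) (hμ₁ : μ ≤ 1) (hy : y = μ • g + (1 - μ) • (h * y))
    (hc : ‖(1 - μ) • h‖ ≤ 1 / 2) : y ∈ convexPolynomialClosure x := by
  have approx : ∀ n : ℕ, ∃ v ∈ convexPolynomialClosure x, ‖v - y‖ ≤ (1 / 2) ^ n * ‖g - y‖ := by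
    intro n
    induction n with
    | zero => exact ⟨g, hg, by simp⟩
    | succ n ih =>
      obtain ⟨v, hv, hvy⟩ := ih
      refine ⟨μ • g + (1 - μ) • (h * v), convex_convexPolynomialClosure x hg
        (mul_mem_convexPolynomialClosure hh hv) hμ₀ (by linarith) (by ring), ?_⟩
      have e : μ • g + (1 - μ) • (h * v) - y = ((1 - μ) • h) * (v - y) := by
        conv_lhs => rw [hy]
        rw [smul_mul_assoc, mul_sub, smul_sub]
        abel
      calc _ = ‖((1 - μ) • h) * (v - y)‖ := by rw [e]
        _ ≤ ‖(1 - μ) • h‖ * ‖v - y‖ := norm_mul_le _ _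
        _ ≤ (1 / 2) * ((1 / 2) ^ n * ‖g - y‖) := by gcongr
        _ = _ := by ring
  choose v hv hvy using approx
  refine isClosed_closure.mem_of_tendsto (b := atTop) (f := v) ?_ (Eventually.of_forall hv)
  rw [tendsto_iff_norm_sub_tendsto_zero]
  refine squeeze_zero (fun _ => norm_nonneg _) hvy ?_
  simpa using (tendsto_pow_atTop_nhds_zero_of_lt_one (r := (1 / 2 : ℝ)) (by norm_num)
    (by norm_num)).mul_const ‖g - y‖

end ConvexClosure

/-! ### Resolvents belong to the closure. -/

section Resolvent

variable {a : ℝ}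

/-- The coordinate function on `[a, -1]`. -/
def coordinate (a : ℝ) : C(Set.Icc a (-1), ℝ) := ⟨fun x => x, continuous_subtype_val⟩

/-- For `0 ≤ z`, this is the function `x ↦ (1 - z) / (1 - z * x)` on `[a, -1]`. -/
noncomputable def normalizedResolvent (a z : ℝ) : C(Set.Icc a (-1), ℝ) where
  -- The absolute value keeps the denominator positive for every real `z`.
  toFun x := (1 - z) / (1 + |z * x|)
  continuous_toFun := by
    refine Continuous.div (by fun_prop) (by fun_prop) fun x => ?_
    positivity

theorem normalizedResolvent_apply {z : ℝ} (hz : 0 ≤ z) (x : Set.Icc a (-1)) :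
    normalizedResolvent a z x = (1 - z) / (1 - z * x) := by
  have hx := x.2.2
  change (1 - z) / (1 + |z * (x : ℝ)|) = _
  rw [abs_of_nonpos (by nlinarith)]
  ring_nf

theorem norm_normalizedResolvent_le {z : ℝ} (hz : z ≤ 1) :
    ‖normalizedResolvent a z‖ ≤ 1 - z := by
  refine (ContinuousMap.norm_le _ (by linarith)).2 fun x => ?_
  change ‖(1 - z) / (1 + |z * (x : ℝ)|)‖ ≤ _
  rw [Real.norm_of_nonneg (div_nonneg (by linarith) (by positivity))]
  exact div_le_self (by linarith) (by linarith [abs_nonneg (z * (x : ℝ))])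

/-- The resolvent identity `R_w = μ R_z + (1 - μ) x R_z R_w`, with `μ = (1 - w) / (1 - z)`, makes
`R_w` a fixed point. The factor `(1 - μ) x R_z = (w - z) x / (1 - z x)` has norm at most `(w - z)
|a| ≤ 1 / 2`. -/
theorem normalizedResolvent_mem_step {z w : ℝ} (ha : a < -1) (hz : 0 ≤ z) (hzw : z ≤ w)
    (hw : w < 1) (hstep : (w - z) * (2 * |a|) ≤ 1)
    (h : normalizedResolvent a z ∈ convexPolynomialClosure (coordinate a)) :
    normalizedResolvent a w ∈ convexPolynomialClosure (coordinate a) := by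
  have hx : coordinate a ∈ convexPolynomialClosure (coordinate a) := by
    simpa using pow_mem_convexPolynomialClosure (coordinate a) 1
  have hz1 : 0 < 1 - z := by linarith
  refine mem_convexPolynomialClosure_of_fixedPoint h (mul_mem_convexPolynomialClosure hx h)
    (μ := (1 - w) / (1 - z)) (by apply div_nonneg <;> linarith)
    ((div_le_one hz1).2 (by linarith)) ?_ ?_
  · ext x
    have hx := x.2.2
    have h1 : 0 < 1 - z * x := by nlinarith
    have h2 : 0 < 1 - w * x := by nlinarith
    simp only [ContinuousMap.add_apply, ContinuousMap.smul_apply, ContinuousMap.mul_apply,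
      normalizedResolvent_apply hz, normalizedResolvent_apply (hz.trans hzw), smul_eq_mul]
    change _ = _ + _ * ((x : ℝ) * _ * _)
    rw [eq_comm]
    have h1' := h1.ne'
    have h2' := h2.ne'
    generalize hu : 1 - z * (x : ℝ) = u at *
    generalize hv : 1 - w * (x : ℝ) = v at *
    field_simp
    rw [← hu, ← hv]
    ring
  · refine (ContinuousMap.norm_le _ (by norm_num)).2 fun x => ?_
    have hx := x.2.2
    have hxa := x.2.1
    have h1 : 1 ≤ 1 - z * x := by nlinarith
    simp only [ContinuousMap.smul_apply, ContinuousMap.mul_apply,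
      normalizedResolvent_apply hz, smul_eq_mul]
    change ‖_ * ((x : ℝ) * _)‖ ≤ _
    have e : (1 - (1 - w) / (1 - z)) * ((x : ℝ) * ((1 - z) / (1 - z * x)))
        = -((w - z) * (-x) / (1 - z * x)) := by
      field_simp
      ring
    rw [e, norm_neg, Real.norm_of_nonneg
      (div_nonneg (mul_nonneg (by linarith) (by linarith)) (by linarith))]
    rw [abs_of_neg (by linarith)] at hstep
    refine (div_le_self (mul_nonneg (by linarith) (by linarith)) h1).trans ?_
    nlinarith

/-- The admissible step length `1 / (2 |a|)` does not depend on `z`, so finitely many steps from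
`R_0 = 1` suffice. -/
theorem normalizedResolvent_mem {z : ℝ} (ha : a < -1) (hz : 0 ≤ z) (hz1 : z < 1) :
    normalizedResolvent a z ∈ convexPolynomialClosure (coordinate a) := by
  have ha' : 0 < 2 * |a| := by
    have := abs_of_neg (show a < 0 by linarith)
    linarith
  have key : ∀ n : ℕ, ∀ z, 0 ≤ z → z < 1 → z * (2 * |a|) ≤ n →
      normalizedResolvent a z ∈ convexPolynomialClosure (coordinate a) := by
    intro n
    induction n with
    | zero =>
      intro z hz _ hzn
      have : z = 0 := by
        push_cast at hzn
        nlinarith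
      subst this
      have e : normalizedResolvent a 0 = coordinate a ^ 0 := by
        ext x
        simp [normalizedResolvent_apply]
      rw [e]
      exact pow_mem_convexPolynomialClosure _ 0
    | succ n ih =>
      intro z hz hz1 hzn
      push_cast at hzn
      have hd : 1 / (2 * |a|) * (2 * |a|) = 1 := one_div_mul_cancel ha'.ne'
      have hd0 : 0 < 1 / (2 * |a|) := by positivity
      rcases le_total (1 / (2 * |a|)) z with h | h
      · refine normalizedResolvent_mem_step (z := z - 1 / (2 * |a|)) ha (by linarith)
          (by linarith) hz1 (by linarith) (ih _ (by linarith) (by linarith) ?_)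
        rw [sub_mul]
        linarith
      · refine normalizedResolvent_mem_step (z := 0) ha le_rfl hz hz1 ?_
          (ih 0 le_rfl one_pos (by simp))
        rw [sub_zero, ← hd]
        gcongr
  obtain ⟨n, hn⟩ := exists_nat_ge (z * (2 * |a|))
  exact key n z hz hz1 hn

end Resolvent

/-! ### Limits of polynomials with small weighted coefficients. -/

section SmallCoefficients

variable {A : Type*} [NormedCommRing A] [NormedAlgebra ℝ A] {x : A} {ρ : ℝ}

/-- The limits of values at `x` of polynomials whose coefficients, weighted by powers of `ρ`,
tend uniformly to zero. -/
def smallCoeffLimits (x : A) (ρ : ℝ) : Set A :=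
  {f | ∀ ε > 0, ∃ p : ℝ[X], ‖Polynomial.aeval x p - f‖ ≤ ε ∧ ∀ n, |p.coeff n| * ρ ^ n ≤ ε}

theorem smallCoeffLimits.add_mem {f g : A} (hρ : 0 ≤ ρ) (hf : f ∈ smallCoeffLimits x ρ)
    (hg : g ∈ smallCoeffLimits x ρ) : f + g ∈ smallCoeffLimits x ρ := by
  intro ε hε
  obtain ⟨p, hp, hp'⟩ := hf (ε / 2) (half_pos hε)
  obtain ⟨q, hq, hq'⟩ := hg (ε / 2) (half_pos hε)
  refine ⟨p + q, ?_, fun n => ?_⟩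
  · rw [map_add, add_sub_add_comm]
    linarith [norm_add_le (Polynomial.aeval x p - f) (Polynomial.aeval x q - g)]
  · rw [Polynomial.coeff_add]
    have := mul_le_mul_of_nonneg_right (abs_add_le (p.coeff n) (q.coeff n)) (pow_nonneg hρ n)
    linarith [hp' n, hq' n]

theorem smallCoeffLimits.smul_mem {f : A} (c : ℝ) (hf : f ∈ smallCoeffLimits x ρ) :
    c • f ∈ smallCoeffLimits x ρ := by
  intro ε hε
  have hc : 0 < |c| + 1 := by positivity
  obtain ⟨p, hp, hp'⟩ := hf (ε / (|c| + 1)) (by positivity)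
  have hle : |c| * (ε / (|c| + 1)) ≤ ε := by
    rw [mul_div_assoc', div_le_iff₀ hc]
    nlinarith
  refine ⟨c • p, ?_, fun n => ?_⟩
  · rw [map_smul, ← smul_sub, norm_smul, Real.norm_eq_abs]
    exact (mul_le_mul_of_nonneg_left hp (abs_nonneg c)).trans hle
  · rw [Polynomial.coeff_smul, smul_eq_mul, abs_mul, mul_assoc]
    exact (mul_le_mul_of_nonneg_left (hp' n) (abs_nonneg c)).trans hle

theorem smallCoeffLimits.generator_mul_mem {f : A} (hρ : 0 ≤ ρ)
    (hf : f ∈ smallCoeffLimits x ρ) : x * f ∈ smallCoeffLimits x ρ := by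
  intro ε hε
  have hc : 0 < ‖x‖ + ρ + 1 := by positivity
  obtain ⟨p, hp, hp'⟩ := hf (ε / (‖x‖ + ρ + 1)) (by positivity)
  have hε' : 0 < ε / (‖x‖ + ρ + 1) := by positivity
  have hle : (‖x‖ + ρ + 1) * (ε / (‖x‖ + ρ + 1)) = ε := mul_div_cancel₀ _ hc.ne'
  refine ⟨Polynomial.X * p, ?_, fun n => ?_⟩
  · rw [map_mul, Polynomial.aeval_X, ← mul_sub]
    refine (norm_mul_le _ _).trans ?_
    nlinarith [norm_nonneg x]
  · cases n with
    | zero => simpa using hε.le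
    | succ n =>
      rw [Polynomial.coeff_X_mul, pow_succ, ← mul_assoc]
      nlinarith [norm_nonneg x, hp' n]

theorem smallCoeffLimits.aeval_mul_mem {f : A} (hρ : 0 ≤ ρ) (hf : f ∈ smallCoeffLimits x ρ)
    (p : ℝ[X]) : Polynomial.aeval x p * f ∈ smallCoeffLimits x ρ := by
  induction p using Polynomial.induction_on' with
  | add p q hp hq =>
    rw [map_add, add_mul]
    exact add_mem hρ hp hq
  | monomial n c =>
    rw [Polynomial.aeval_monomial, ← Algebra.smul_def, smul_mul_assoc]
    refine smul_mem c ?_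
    induction n with
    | zero => simpa using hf
    | succ n ih =>
      rw [pow_succ', mul_assoc]
      exact generator_mul_mem hρ ih

theorem smallCoeffLimits.mem_of_approx {f : A}
    (h : ∀ ε > 0, ∃ g ∈ smallCoeffLimits x ρ, ‖g - f‖ ≤ ε) : f ∈ smallCoeffLimits x ρ := by
  intro ε hε
  obtain ⟨g, hg, hgf⟩ := h (ε / 2) (half_pos hε)
  obtain ⟨p, hp, hp'⟩ := hg (ε / 2) (half_pos hε)
  refine ⟨p, ?_, fun n => (hp' n).trans (by linarith)⟩
  linarith [norm_sub_le_norm_sub_add_norm_sub (Polynomial.aeval x p) g f]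

end SmallCoefficients

theorem aeval_coordinate_apply {a : ℝ} (p : ℝ[X]) (x : Set.Icc a (-1)) :
    Polynomial.aeval (coordinate a) p x = p.eval (x : ℝ) := by
  induction p using Polynomial.induction_on' with
  | add p q hp hq => simp [hp, hq]
  | monomial n c =>
    simp only [Polynomial.aeval_monomial, Polynomial.eval_monomial]
    rfl

theorem exists_aeval_coordinate_near {a : ℝ} (f : C(Set.Icc a (-1), ℝ)) {ε : ℝ} (hε : 0 < ε) :
    ∃ p : ℝ[X], ‖Polynomial.aeval (coordinate a) p - f‖ < ε := by
  obtain ⟨p, hp⟩ := exists_polynomial_near_continuousMap a (-1) f ε hε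
  refine ⟨p, ?_⟩
  convert hp using 3
  ext x
  rw [aeval_coordinate_apply]
  rfl

/-- Stability under polynomial factors passes to all continuous factors by Weierstrass
approximation. -/
theorem smallCoeffLimits.mul_mem {a ρ : ℝ} (hρ : 0 ≤ ρ) {f : C(Set.Icc a (-1), ℝ)}
    (hf : f ∈ smallCoeffLimits (coordinate a) ρ) (g : C(Set.Icc a (-1), ℝ)) :
    g * f ∈ smallCoeffLimits (coordinate a) ρ := by
  refine mem_of_approx fun ε hε => ?_
  have hc : 0 < ‖f‖ + 1 := by positivity
  obtain ⟨p, hp⟩ := exists_aeval_coordinate_near g (ε := ε / (‖f‖ + 1)) (by positivity)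
  refine ⟨_, aeval_mul_mem hρ hf p, ?_⟩
  rw [← sub_mul]
  refine (norm_mul_le _ _).trans ?_
  have : ε / (‖f‖ + 1) * (‖f‖ + 1) = ε := div_mul_cancel₀ _ hc.ne'
  have hε' : 0 < ε / (‖f‖ + 1) := by positivity
  nlinarith [norm_nonneg f]

/-! ### Ramps, and functions vanishing near `-1`, as limits with small coefficients. -/

/-- The Taylor polynomials of `1 - exp (-(c * x ^ m))` have small coefficients. -/
theorem exists_polynomial_near_one_sub_exp {A : Type*} [NormedCommRing A] [NormedAlgebra ℝ A]
    [CompleteSpace A] (x : A) {c ρ : ℝ} {m : ℕ} (hm : 0 < m) (hρ : 0 ≤ ρ)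
    (hc : |c| * ρ ^ m ≤ 1) {ε : ℝ} (hε : 0 < ε) :
    ∃ p : ℝ[X], ‖Polynomial.aeval x p - (1 - NormedSpace.exp (-(c • x ^ m)))‖ ≤ ε ∧
      ∀ n, |p.coeff n| * ρ ^ n ≤ |c| * ρ ^ m := by
  have hsum := NormedSpace.exp_series_hasSum_exp' (𝕂 := ℝ) (-(c • x ^ m))
  rw [← hasSum_nat_add_iff' 1] at hsum
  have hlim := hsum.tendsto_sum_nat.neg
  obtain ⟨K, hK⟩ := (Metric.tendsto_atTop.1 hlim) ε hε
  have hK := (hK K le_rfl).le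
  set q : ℝ[X] := ∑ k ∈ Finset.range K,
    Polynomial.monomial (k + 1) (-(((k + 1).factorial : ℝ)⁻¹ * (-c) ^ (k + 1))) with hq
  -- The constant term is zero; for `n ≥ 1` the left side is at most `(|c| ρ ^ m) ^ n / n!`, and the
  -- base is at most `1`.
  have hcoeff : ∀ n, |q.coeff n| * ρ ^ (n * m) ≤ |c| * ρ ^ m := by
    intro n
    have hnn : 0 ≤ |c| * ρ ^ m := by positivity
    rw [hq, Polynomial.finsetSum_coeff]
    cases n with
    | zero => simpa [Polynomial.coeff_monomial] using hnn
    | succ n =>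
      simp only [Polynomial.coeff_monomial, add_left_inj, Finset.sum_ite_eq']
      split_ifs
      · have hf : (((n + 1).factorial : ℝ)⁻¹) ≤ 1 :=
          inv_le_one_of_one_le₀ (by exact_mod_cast (n + 1).factorial_pos)
        rw [abs_neg, abs_mul, abs_pow, abs_neg, abs_of_nonneg (by positivity), mul_comm (n + 1) m,
          pow_mul, mul_assoc, ← mul_pow]
        calc _ ≤ 1 * (|c| * ρ ^ m) ^ (n + 1) := by gcongr
          _ ≤ |c| * ρ ^ m := by
            rw [one_mul]
            exact pow_le_of_le_one hnn hc n.succ_ne_zero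
      · simpa using hnn
  refine ⟨Polynomial.expand ℝ m q, ?_, fun n => ?_⟩
  · have e₁ : Polynomial.aeval x (Polynomial.expand ℝ m q)
        = -∑ k ∈ Finset.range K, ((k + 1).factorial : ℝ)⁻¹ • (-(c • x ^ m)) ^ (k + 1) := by
      rw [Polynomial.expand_aeval, hq, map_sum, ← Finset.sum_neg_distrib]
      refine Finset.sum_congr rfl fun k _ => ?_
      rw [Polynomial.aeval_monomial, ← Algebra.smul_def, ← neg_smul c, smul_pow, smul_smul,
        neg_smul]
    rw [dist_eq_norm, ← e₁] at hK
    simpa using hK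
  · rw [Polynomial.coeff_expand hm]
    split_ifs with h
    · obtain ⟨k, rfl⟩ := h
      rw [Nat.mul_div_cancel_left k hm, mul_comm m k]
      exact hcoeff k
    · simpa using (by positivity : 0 ≤ |c| * ρ ^ m)

theorem one_sub_mul_pow_le {s : ℝ} (hs : 0 ≤ s) (hs1 : s ≤ 1) (m : ℕ) :
    m * ((1 - s) * s ^ m) ≤ 1 := by
  have h : (m : ℝ) * s ^ m ≤ ∑ k ∈ Finset.range m, s ^ k := by
    have := Finset.card_nsmul_le_sum (Finset.range m) (fun k => s ^ k) (s ^ m)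
      fun k hk => pow_le_pow_of_le_one hs hs1 (Finset.mem_range.1 hk).le
    simpa using this
  have h2 := mul_neg_geom_sum s m
  have h3 := mul_le_mul_of_nonneg_left h (sub_nonneg.2 hs1)
  have h4 := pow_nonneg hs m
  linarith

/-- `1 - exp (-s ^ m)` is a smooth step at `s = 1`, and the factor `s - 1` suppresses the transition
there. Below `1` the bound comes from the geometric sum, above `1` from Bernoulli's inequality. -/
theorem abs_mul_one_sub_exp_neg_pow_sub_max_le {s : ℝ} (hs : 0 ≤ s) {m : ℕ} (hm : 0 < m) :
    |(s - 1) * (1 - Real.exp (-s ^ m)) - max (s - 1) 0| ≤ 1 / m := by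
  have hm' : (0 : ℝ) < m := by exact_mod_cast hm
  rw [le_div_iff₀ hm']
  rcases le_total s 1 with h | h
  · rw [max_eq_right (by linarith), sub_zero, abs_mul, abs_of_nonpos (by linarith)]
    have h1 : Real.exp (-s ^ m) ≤ 1 := Real.exp_le_one_iff.2 (by simpa using pow_nonneg hs m)
    have h2 := Real.add_one_le_exp (-s ^ m)
    rw [abs_of_nonneg (by linarith)]
    have h3 := one_sub_mul_pow_le hs h m
    have h4 : (1 - s) * (1 - Real.exp (-s ^ m)) ≤ (1 - s) * s ^ m :=
      mul_le_mul_of_nonneg_left (by linarith) (by linarith)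
    nlinarith
  · rw [max_eq_left (by linarith)]
    have e : (s - 1) * (1 - Real.exp (-s ^ m)) - (s - 1) = -((s - 1) * Real.exp (-s ^ m)) := by
      ring
    rw [e, abs_neg, abs_of_nonneg (mul_nonneg (by linarith) (Real.exp_pos _).le)]
    have h1 := one_add_mul_sub_le_pow (show -1 ≤ s by linarith) m
    have h2 := Real.add_one_le_exp (s ^ m)
    rw [Real.exp_neg, mul_assoc, mul_comm, mul_assoc, inv_mul_le_iff₀ (Real.exp_pos _)]
    linarith

/-- The function `x ↦ max (-x - τ) 0` on `[a, -1]`. -/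
def ramp (a τ : ℝ) : C(Set.Icc a (-1), ℝ) := ⟨fun x => max (-x - τ) 0, by fun_prop⟩

/-- The approximants are `(-x - τ)` times Taylor polynomials of `1 - exp (-(-x / τ) ^ m)`, whose
weighted coefficients are at most `(ρ / τ) ^ m → 0`. -/
theorem ramp_mem_smallCoeffLimits {a ρ τ : ℝ} (hρ : 0 ≤ ρ) (hτ : ρ < τ) :
    ramp a τ ∈ smallCoeffLimits (coordinate a) ρ := by
  have hτ0 : 0 < τ := hρ.trans_lt hτ
  have hone : ∀ ε > 0, ∃ m : ℕ, 0 < m ∧ τ / m ≤ ε ∧ (ρ / τ) ^ m ≤ ε ∧ (ρ / τ) ^ m ≤ 1 := by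
    intro ε hε
    have h1 := tendsto_const_div_atTop_nhds_zero_nat τ
    have h2 := tendsto_pow_atTop_nhds_zero_of_lt_one (div_nonneg hρ hτ0.le)
      ((div_lt_one hτ0).2 hτ)
    obtain ⟨m, h⟩ := ((eventually_gt_atTop 0).and ((h1.eventually_le_const hε).and
      ((h2.eventually_le_const hε).and (h2.eventually_le_const one_pos)))).exists
    exact ⟨m, h⟩
  intro ε hε
  have hcst : 0 < |a| + 2 * τ + 1 := by positivity
  -- `M` dominates `|-x - τ|` on `[a, -1]`, the coefficient factor `ρ + τ`, and `1`.
  set M := |a| + 2 * τ + 1 with hM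
  obtain ⟨m, hm, hm1, hm2, hm3⟩ := hone (ε / (2 * M)) (by positivity)
  have hεM : ε / (2 * M) * M = ε / 2 := by field_simp
  have hεM' : 0 < ε / (2 * M) := by positivity
  have hc : |(-1 / τ) ^ m| * ρ ^ m = (ρ / τ) ^ m := by
    rw [abs_pow, abs_div, abs_neg, abs_one, abs_of_pos hτ0, ← mul_pow]
    ring
  obtain ⟨p, hp, hp'⟩ := exists_polynomial_near_one_sub_exp (coordinate a) hm hρ
    (hc.le.trans hm3) hεM'
  simp only [hc] at hp'
  have hM1 : 1 ≤ M := by rw [hM]; linarith [abs_nonneg a]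
  refine ⟨(-Polynomial.X - Polynomial.C τ) * p, ?_, fun n => ?_⟩
  · refine (ContinuousMap.norm_le _ hε.le).2 fun x => ?_
    have hx := x.2.2
    have hxa := x.2.1
    have hpx := (ContinuousMap.norm_coe_le_norm _ x).trans hp
    have hexp : NormedSpace.exp (-((-1 / τ) ^ m • coordinate a ^ m)) x
        = Real.exp (-(-(x : ℝ) / τ) ^ m) := by
      have := NormedSpace.map_exp (ContinuousMap.evalAlgHom ℝ ℝ x)
        (continuous_eval_const x) (-((-1 / τ) ^ m • coordinate a ^ m))
      rw [← Real.exp_eq_exp_ℝ] at this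
      refine this.trans ?_
      congr 1
      change -((-1 / τ) ^ m * (x : ℝ) ^ m) = _
      rw [← mul_pow]
      congr 2
      ring
    rw [ContinuousMap.sub_apply, ContinuousMap.sub_apply, aeval_coordinate_apply, hexp] at hpx
    rw [ContinuousMap.sub_apply, aeval_coordinate_apply]
    change ‖_ - max (-(x : ℝ) - τ) 0‖ ≤ ε
    simp only [Polynomial.eval_mul, Polynomial.eval_sub, Polynomial.eval_neg, Polynomial.eval_X,
      Polynomial.eval_C]
    rw [ContinuousMap.one_apply, Real.norm_eq_abs] at hpx
    have hr := abs_mul_one_sub_exp_neg_pow_sub_max_le (s := -(x : ℝ) / τ)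
      (div_nonneg (by linarith) hτ0.le) hm
    set E := Real.exp (-(-(x : ℝ) / τ) ^ m)
    have hmax : max (-(x : ℝ) - τ) 0 = τ * max (-(x : ℝ) / τ - 1) 0 := by
      rw [mul_max_of_nonneg _ _ hτ0.le, mul_zero, mul_sub, mul_div_cancel₀ _ hτ0.ne', mul_one]
    have hlin : -(x : ℝ) - τ = τ * (-(x : ℝ) / τ - 1) := by
      rw [mul_sub, mul_div_cancel₀ _ hτ0.ne', mul_one]
    have e : (-(x : ℝ) - τ) * p.eval (x : ℝ) - max (-(x : ℝ) - τ) 0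
        = (-(x : ℝ) - τ) * (p.eval (x : ℝ) - (1 - E))
          + τ * ((-(x : ℝ) / τ - 1) * (1 - E) - max (-(x : ℝ) / τ - 1) 0) := by
      rw [hmax, mul_sub τ, ← mul_assoc τ, ← hlin]
      ring
    rw [e, Real.norm_eq_abs]
    refine (abs_add_le _ _).trans ?_
    rw [abs_mul, abs_mul, abs_of_pos hτ0]
    have h1 : |-(x : ℝ) - τ| ≤ M := by
      rw [abs_le]
      constructor <;> linarith [neg_abs_le a, abs_nonneg a]
    have h2 : |-(x : ℝ) - τ| * |p.eval (x : ℝ) - (1 - E)| ≤ M * (ε / (2 * M)) := by gcongr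
    have h3 := mul_le_mul_of_nonneg_left hr hτ0.le
    rw [mul_one_div] at h3
    have h4 : ε / (2 * M) ≤ ε / (2 * M) * M := le_mul_of_one_le_right hεM'.le hM1
    linarith
  · have key : |((-Polynomial.X - Polynomial.C τ) * p).coeff n| * ρ ^ n
        ≤ (ρ + τ) * (ε / (2 * M)) := by
      have h0 := (hp' n).trans hm2
      rw [sub_mul, Polynomial.coeff_sub, Polynomial.coeff_C_mul, neg_mul, Polynomial.coeff_neg]
      have hb := mul_le_mul_of_nonneg_left h0 hτ0.le
      cases n with
      | zero =>
        simp only [Polynomial.coeff_X_mul_zero, neg_zero, zero_sub, abs_neg, abs_mul,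
          abs_of_pos hτ0, mul_assoc]
        nlinarith
      | succ n =>
        have h1 := mul_le_mul_of_nonneg_left ((hp' n).trans hm2) hρ
        rw [Polynomial.coeff_X_mul]
        have h2 := abs_sub (-p.coeff n) (τ * p.coeff (n + 1))
        rw [abs_neg, abs_mul, abs_of_pos hτ0] at h2
        have h3 := mul_le_mul_of_nonneg_right h2 (pow_nonneg hρ (n + 1))
        have h4 : |p.coeff n| * ρ ^ (n + 1) = ρ * (|p.coeff n| * ρ ^ n) := by ring
        linarith
    refine key.trans ?_
    have : (ρ + τ) * (ε / (2 * M)) ≤ M * (ε / (2 * M)) :=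
      mul_le_mul_of_nonneg_right (by rw [hM]; linarith [abs_nonneg a]) hεM'.le
    linarith

theorem mem_smallCoeffLimits_of_eq_zero {a ρ d : ℝ} (hρ : 0 ≤ ρ) (hd : ρ < -d)
    {f : C(Set.Icc a (-1), ℝ)} (hf : ∀ x : Set.Icc a (-1), d ≤ x → f x = 0) :
    f ∈ smallCoeffLimits (coordinate a) ρ := by
  -- With `s` half the gap, the ramp starting at `ρ + s` is at least `s` where `x ≤ d`, so `f` is
  -- divisible by it.
  set s := (-d - ρ) / 2 with hs
  have hs0 : 0 < s := by rw [hs]; linarith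
  have hpos : ∀ x : Set.Icc a (-1), 0 < max (ramp a (ρ + s) x) s := fun x => lt_max_of_lt_right hs0
  let g : C(Set.Icc a (-1), ℝ) :=
    ⟨fun x => f x / max (ramp a (ρ + s) x) s,
      Continuous.div (by fun_prop) (by fun_prop) fun x => (hpos x).ne'⟩
  have hfg : f = g * ramp a (ρ + s) := by
    ext x
    change f x = f x / max (ramp a (ρ + s) x) s * ramp a (ρ + s) x
    rcases le_total d x with h | h
    · simp [hf x h]
    · have hle : s ≤ ramp a (ρ + s) x := by
        change s ≤ max (-(x : ℝ) - (ρ + s)) 0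
        exact le_max_of_le_left (by linarith)
      rw [max_eq_left hle, div_mul_cancel₀ _ (hs0.trans_le hle).ne']
  rw [hfg]
  exact smallCoeffLimits.mul_mem hρ (ramp_mem_smallCoeffLimits hρ (by linarith)) g

/-! ### From small coefficients to the closure of the convex-polynomials. -/

theorem zero_mem_convexPolynomialClosure {a : ℝ} (ha : a < -1) :
    (0 : C(Set.Icc a (-1), ℝ)) ∈ convexPolynomialClosure (coordinate a) := by
  have : (𝓝[Set.Ico 0 1] (1 : ℝ)).NeBot := by
    rw [← mem_closure_iff_nhdsWithin_neBot, closure_Ico zero_ne_one]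
    exact ⟨zero_le_one, le_rfl⟩
  refine isClosed_closure.mem_of_tendsto (b := 𝓝[Set.Ico 0 1] (1 : ℝ))
    (f := fun z => normalizedResolvent a z) ?_ ?_
  · refine squeeze_zero_norm' (a := fun z : ℝ => 1 - z) ?_ ?_
    · filter_upwards [self_mem_nhdsWithin] with z hz
      exact norm_normalizedResolvent_le hz.2.le
    · refine tendsto_nhdsWithin_of_tendsto_nhds ?_
      exact (by fun_prop : Continuous fun z : ℝ => 1 - z).tendsto' _ _ (sub_self 1)
  · filter_upwards [self_mem_nhdsWithin] with z hz
    exact normalizedResolvent_mem ha hz.1 hz.2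

theorem smul_mem_convexPolynomialClosure {a t : ℝ} (ha : a < -1) {f : C(Set.Icc a (-1), ℝ)}
    (hf : f ∈ convexPolynomialClosure (coordinate a)) (ht : 0 ≤ t) (ht1 : t ≤ 1) :
    t • f ∈ convexPolynomialClosure (coordinate a) :=
  (convex_convexPolynomialClosure _).smul_mem_of_zero_mem (zero_mem_convexPolynomialClosure ha)
    hf ⟨ht, ht1⟩

theorem aeval_mem_convexPolynomialClosure_of_eval_one_le {a : ℝ} (ha : a < -1) {p : ℝ[X]}
    (hp : ∀ n, 0 ≤ p.coeff n) (hp1 : p.eval 1 ≤ 1) :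
    Polynomial.aeval (coordinate a) p ∈ convexPolynomialClosure (coordinate a) := by
  have hsum : p.eval 1 = ∑ i ∈ Finset.range (p.natDegree + 1), p.coeff i := by
    rw [Polynomial.eval_eq_sum_range]
    simp
  have h0 : 0 ≤ p.eval 1 := hsum ▸ Finset.sum_nonneg fun i _ => hp i
  rcases h0.eq_or_lt with h | h
  · have : p = 0 := by
      rw [← Polynomial.leadingCoeff_eq_zero]
      refine (Finset.sum_eq_zero_iff_of_nonneg fun i _ => hp i).1 (hsum.symm.trans h.symm) _ ?_
      simp
    rw [this, map_zero]
    exact zero_mem_convexPolynomialClosure ha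
  · have e : p = p.eval 1 • ((p.eval 1)⁻¹ • p) := by
      rw [smul_smul, mul_inv_cancel₀ h.ne', one_smul]
    rw [e, map_smul]
    refine smul_mem_convexPolynomialClosure ha (aeval_mem_convexPolynomialClosure _ ?_) h0 hp1
    rw [mem_convexPolynomials_iff]
    refine ⟨fun n => ?_, ?_⟩
    · rw [Polynomial.coeff_smul, smul_eq_mul]
      exact mul_nonneg (inv_nonneg.2 h0) (hp n)
    · rw [Polynomial.eval_smul, smul_eq_mul, inv_mul_cancel₀ h.ne']

/-- The tail of the geometric series, possibly divergent, is replaced by its closed form, which is a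
multiple of a product in the closure. -/
theorem geom_sum_add_pow_mul_normalizedResolvent {a r : ℝ} (hr : 0 ≤ r) (hr1 : r < 1) (N : ℕ) :
    Polynomial.aeval (coordinate a) (∑ n ∈ Finset.range N, Polynomial.monomial n (r ^ n))
      + (r ^ N / (1 - r)) • (coordinate a ^ N * normalizedResolvent a r)
      = (1 - r)⁻¹ • normalizedResolvent a r := by
  ext x
  have hx := x.2.2
  have hrx : 0 < 1 - r * x := by nlinarith
  have hr' : (1 - r) ≠ 0 := by linarith
  have hgeom := geom_sum_mul_neg (r * (x : ℝ)) N
  rw [ContinuousMap.add_apply, aeval_coordinate_apply, ContinuousMap.smul_apply,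
    ContinuousMap.smul_apply, ContinuousMap.mul_apply, normalizedResolvent_apply hr,
    Polynomial.eval_finsetSum, smul_eq_mul, smul_eq_mul]
  simp only [Polynomial.eval_monomial, ← mul_pow]
  change _ + r ^ N / (1 - r) * ((x : ℝ) ^ N * _) = _
  rw [← eq_div_iff hrx.ne'] at hgeom
  have e₁ : r ^ N / (1 - r) * ((x : ℝ) ^ N * ((1 - r) / (1 - r * x)))
      = (r * x) ^ N / (1 - r * x) := by
    rw [mul_pow]
    field_simp
  have e₂ : (1 - r)⁻¹ * ((1 - r) / (1 - r * (x : ℝ))) = 1 / (1 - r * x) := by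
    field_simp
  rw [hgeom, e₁, e₂, ← add_div]
  ring

theorem mem_convexPolynomialClosure_of_mem_smallCoeffLimits {a ρ : ℝ} (ha : a < -1) (hρ : 1 < ρ)
    {f : C(Set.Icc a (-1), ℝ)} (hf : f ∈ smallCoeffLimits (coordinate a) ρ) :
    f ∈ convexPolynomialClosure (coordinate a) := by
  rw [convexPolynomialClosure, ← closure_closure, Metric.mem_closure_iff]
  intro ε hε
  have hρ0 : 0 < ρ := by linarith
  set r := ρ⁻¹ with hr
  have hr0 : 0 ≤ r := inv_nonneg.2 hρ0.le
  have hr1 : r < 1 := inv_lt_one_of_one_lt₀ hρ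
  have hr1' : 0 < 1 - r := by linarith
  -- The bound `ε / 3` covers two errors of size `δ`; `(1 - r) / 4` leaves room for the factors `2`
  -- that the final averaging undoes.
  set δ := min (ε / 3) ((1 - r) / 4) with hδ
  have hδ0 : 0 < δ := lt_min (by positivity) (by positivity)
  have hδε : δ ≤ ε / 3 := min_le_left _ _
  have hδr : δ ≤ (1 - r) / 4 := min_le_right _ _
  obtain ⟨p, hp, hp'⟩ := hf δ hδ0
  have hcoeff : ∀ n, |p.coeff n| ≤ δ * r ^ n := by
    intro n
    rw [hr, inv_pow, ← div_eq_mul_inv, le_div_iff₀ (pow_pos hρ0 n)]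
    exact hp' n
  set N := p.natDegree + 1 with hN
  set G : ℝ[X] := ∑ n ∈ Finset.range N, Polynomial.monomial n (r ^ n) with hG
  have hGcoeff : ∀ n, G.coeff n = if n < N then r ^ n else 0 := by
    intro n
    rw [hG, Polynomial.finsetSum_coeff]
    simp [Polynomial.coeff_monomial]
  have hG1 : G.eval 1 ≤ (1 - r)⁻¹ := by
    rw [hG, Polynomial.eval_finsetSum]
    simp only [Polynomial.eval_monomial, one_pow, mul_one]
    rw [← one_div, le_div_iff₀ hr1', geom_sum_mul_neg]
    linarith [pow_nonneg hr0 N]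
  have hp1 : p.eval 1 ≤ δ * G.eval 1 := by
    rw [hG, Polynomial.eval_finsetSum, Polynomial.eval_eq_sum_range, Finset.mul_sum]
    refine Finset.sum_le_sum fun n _ => ?_
    simpa using (le_abs_self _).trans (hcoeff n)
  have hδr' : δ * (1 - r)⁻¹ ≤ 1 / 4 := by
    rw [← div_eq_mul_inv, div_le_iff₀ hr1']
    linarith
  have hδG : δ * G.eval 1 ≤ 1 / 4 := (mul_le_mul_of_nonneg_left hG1 hδ0.le).trans hδr'
  have hP : Polynomial.aeval (coordinate a) ((2 : ℝ) • (p + δ • G))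
      ∈ convexPolynomialClosure (coordinate a) := by
    refine aeval_mem_convexPolynomialClosure_of_eval_one_le ha (fun n => ?_) ?_
    · rw [Polynomial.coeff_smul, Polynomial.coeff_add, Polynomial.coeff_smul, hGcoeff,
        smul_eq_mul, smul_eq_mul]
      refine mul_nonneg zero_le_two ?_
      split_ifs with h
      · linarith [neg_abs_le (p.coeff n), hcoeff n]
      · rw [Polynomial.coeff_eq_zero_of_natDegree_lt (by omega)]
        simp
    · rw [Polynomial.eval_smul, Polynomial.eval_add, Polynomial.eval_smul, smul_eq_mul,
        smul_eq_mul]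
      linarith
  have hR := normalizedResolvent_mem ha hr0 hr1
  have hQ := smul_mem_convexPolynomialClosure ha (t := 2 * (δ * (r ^ N / (1 - r))))
    (mul_mem_convexPolynomialClosure (pow_mem_convexPolynomialClosure (coordinate a) N) hR)
    (by positivity) (by
      have : r ^ N ≤ 1 := pow_le_one₀ hr0 hr1.le
      have : δ * (r ^ N / (1 - r)) ≤ δ * (1 - r)⁻¹ := by
        rw [← one_div]
        gcongr
      linarith)
  have hmem := convex_convexPolynomialClosure (coordinate a) hP hQ
    (show (0 : ℝ) ≤ 1 / 2 by norm_num) (show (0 : ℝ) ≤ 1 / 2 by norm_num) (by norm_num)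
  refine ⟨_, hmem, ?_⟩
  have e : (1 / 2 : ℝ) • Polynomial.aeval (coordinate a) ((2 : ℝ) • (p + δ • G))
      + (1 / 2 : ℝ) • (2 * (δ * (r ^ N / (1 - r)))) • (coordinate a ^ N * normalizedResolvent a r)
      = Polynomial.aeval (coordinate a) p + δ • ((1 - r)⁻¹ • normalizedResolvent a r) := by
    rw [← geom_sum_add_pow_mul_normalizedResolvent hr0 hr1 N, map_smul, map_add, map_smul]
    module
  rw [e, dist_comm, dist_eq_norm, add_sub_right_comm]
  have hn : ‖δ • ((1 - r)⁻¹ • normalizedResolvent a r)‖ ≤ δ := by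
    rw [norm_smul, norm_smul, Real.norm_of_nonneg hδ0.le,
      Real.norm_of_nonneg (inv_nonneg.2 hr1'.le)]
    refine mul_le_of_le_one_right hδ0.le ?_
    rw [inv_mul_le_iff₀ hr1', mul_one]
    exact norm_normalizedResolvent_le hr1.le
  linarith [norm_add_le (Polynomial.aeval (coordinate a) p - f)
    (δ • ((1 - r)⁻¹ • normalizedResolvent a r))]

/-- Convex-polynomials approximate uniformly on `[a, -1]` every continuous function that vanishes
near `-1`. -/
theorem exists_convexPolynomial_near {a d ε : ℝ} (ha : a < -1) (hd : d < -1) (hε : 0 < ε)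
    {f : C(Set.Icc a (-1), ℝ)} (hf : ∀ x : Set.Icc a (-1), d ≤ x → f x = 0) :
    ∃ p ∈ convexPolynomials, ∀ x : Set.Icc a (-1), |p.eval (x : ℝ) - f x| ≤ ε := by
  -- This `ρ` is the midpoint of `1` and `-d`.
  have hmem := mem_convexPolynomialClosure_of_mem_smallCoeffLimits (ρ := (1 - d) / 2) ha
    (by linarith) (mem_smallCoeffLimits_of_eq_zero (by linarith) (by linarith) hf)
  obtain ⟨_, ⟨p, hp, rfl⟩, hpf⟩ := Metric.mem_closure_iff.1 hmem ε hε
  refine ⟨p, hp, fun x => ?_⟩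
  rw [dist_comm, dist_eq_norm] at hpf
  have := (ContinuousMap.norm_coe_le_norm _ x).trans hpf.le
  rwa [ContinuousMap.sub_apply, aeval_coordinate_apply, Real.norm_eq_abs] at this

/-! ### Reduction of strict approximation to uniform approximation. -/

/-- A bounded continuous function on `(a, b)` agrees on `[c, d] ⊆ (a, b)` with a continuous function
on `[a, -1]` that has the same bound and vanishes to the right of some `d' < b`. -/
theorem exists_cutoff {a b c d : ℝ} (hac : a < c) (hcd : c ≤ d) (hdb : d < b)
    (f : Set.Ioo a b →ᵇ ℝ) :
    ∃ d' < b, ∃ g : C(Set.Icc a (-1), ℝ), (∀ x, |g x| ≤ ‖f‖) ∧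
      (∀ x : Set.Icc a (-1), d' ≤ x → g x = 0) ∧
      ∀ (x : Set.Icc a (-1)) (y : Set.Ioo a b), (x : ℝ) = y → (y : ℝ) ∈ Set.Icc c d →
        g x = f y := by
  have hsub : ∀ x : Set.Icc c d, (x : ℝ) ∈ Set.Ioo a b := fun x =>
    ⟨hac.trans_le x.2.1, x.2.2.trans_lt hdb⟩
  obtain ⟨d', hdd', hd'b⟩ := exists_between hdb
  have hpos : 0 < d' - d := sub_pos.2 hdd'
  let F : ℝ → ℝ := Set.IccExtend hcd fun x => f ⟨x, hsub x⟩
  have hF : Continuous F := Continuous.Icc_extend' (by fun_prop)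
  let χ : ℝ → ℝ := fun x => max 0 (min 1 ((d' - x) / (d' - d)))
  have hχ : Continuous χ := by fun_prop
  refine ⟨d', hd'b, ⟨fun x => F x * χ x, by fun_prop⟩, fun x => ?_, fun x hx => ?_,
    fun x y hxy hy => ?_⟩
  · change |F x * χ x| ≤ _
    rw [abs_mul]
    have h1 : |F x| ≤ ‖f‖ := f.norm_coe_le_norm _
    have h2 : |χ x| ≤ 1 := by
      rw [abs_of_nonneg (le_max_left _ _)]
      exact max_le zero_le_one (min_le_left _ _)
    exact (mul_le_mul h1 h2 (abs_nonneg _) (norm_nonneg _)).trans_eq (mul_one _)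
  · change F x * χ x = 0
    have : χ x = 0 := max_eq_left
      ((min_le_right _ _).trans (div_nonpos_of_nonpos_of_nonneg (by linarith) hpos.le))
    rw [this, mul_zero]
  · change F x * χ x = _
    have h1 : χ x = 1 := by
      have : 1 ≤ (d' - (x : ℝ)) / (d' - d) := by
        rw [one_le_div hpos, hxy]
        linarith [hy.2]
      simp [χ, min_eq_left this]
    have h2 : F x = f y := by
      change Set.IccExtend hcd _ (x : ℝ) = _
      rw [hxy, Set.IccExtend_of_mem hcd _ hy]
    rw [h1, h2, mul_one]

theorem exists_Icc_forall_notMem_abs_le {a b : ℝ} (hab : a < b) (s : Finset C₀(Set.Ioo a b, ℝ))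
    {η : ℝ} (hη : 0 < η) :
    ∃ c d, a < c ∧ c ≤ d ∧ d < b ∧
      ∀ φ ∈ s, ∀ x : Set.Ioo a b, (x : ℝ) ∉ Set.Icc c d → |φ x| ≤ η := by
  have hev : ∀ᶠ x in cocompact (Set.Ioo a b), ∀ φ ∈ s, |φ x| ≤ η := by
    rw [Filter.eventually_all_finset]
    intro φ _
    exact ((φ.zero_at_infty').abs.eventually_le_const (by simpa using hη))
  obtain ⟨K, hK, hKs⟩ := mem_cocompact.1 hev
  have hK' : IsCompact (Subtype.val '' K) := hK.image continuous_subtype_val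
  -- The extra point `m` covers the case of empty `K`.
  obtain ⟨m, hm⟩ := exists_between hab
  have hK'' := hK'.insert m
  have hne : (insert m (Subtype.val '' K)).Nonempty := Set.insert_nonempty _ _
  have hsub : insert m (Subtype.val '' K) ⊆ Set.Ioo a b := by
    rintro _ (rfl | ⟨x, _, rfl⟩)
    exacts [hm, x.2]
  refine ⟨_, _, (hsub (hK''.sInf_mem hne)).1,
    csInf_le_csSup hne hK''.bddBelow hK''.bddAbove, (hsub (hK''.sSup_mem hne)).2, ?_⟩
  intro φ hφ x hx
  refine hKs (fun hxK => hx ?_) φ hφ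
  have : (x : ℝ) ∈ insert m (Subtype.val '' K) := Or.inr ⟨x, hxK, rfl⟩
  exact ⟨csInf_le hK''.bddBelow this, le_csSup hK''.bddAbove this⟩

theorem mainTheorem10 (a b : ℝ) (hab : a < b) (hb : b ≤ -1) :
    @Dense (Set.Ioo a b →ᵇ ℝ) (strictTopology (Set.Ioo a b))
      {f | ∃ p ∈ convexPolynomials, ∀ x : Set.Ioo a b, f x = p.eval (x : ℝ)} := by
  let _ : TopologicalSpace (Set.Ioo a b →ᵇ ℝ) := strictTopology (Set.Ioo a b)
  have hseminorms : WithSeminorms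
      (fun φ : C₀(Set.Ioo a b, ℝ) => strictSeminorm φ) := ⟨rfl⟩
  intro f
  rw [mem_closure_iff_nhds]
  intro U hU
  obtain ⟨s, r, hr, hsU⟩ := (hseminorms.mem_nhds_iff f U).1 hU
  obtain ⟨C, hC⟩ : ∃ C : ℝ, ∀ φ ∈ s, ‖φ‖ ≤ C :=
    ⟨∑ φ ∈ s, ‖φ‖, fun φ hφ => Finset.single_le_sum (f := fun φ : C₀(Set.Ioo a b, ℝ) => ‖φ‖)
      (fun _ _ => norm_nonneg _) hφ⟩
  -- On `[c, d]` the weights are bounded and `|p - f| ≤ ε`. Elsewhere the weights are at most `η`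
  -- and `|p - f| ≤ 2 ‖f‖ + 1`, because `p` stays within `ε ≤ 1` of a cutoff bounded by `‖f‖`.
  set η := r / (2 * (2 * ‖f‖ + 1)) with hη
  set ε := min 1 (r / (2 * (|C| + 1))) with hε
  have hη0 : 0 < η := by positivity
  have hε0 : 0 < ε := lt_min one_pos (by positivity)
  obtain ⟨c, d, hac, hcd, hdb, hsmall⟩ := exists_Icc_forall_notMem_abs_le hab s hη0
  obtain ⟨d', hd'b, g, hgf, hg0, hgeq⟩ := exists_cutoff hac hcd hdb f
  obtain ⟨p, hp, hpg⟩ := exists_convexPolynomial_near (by linarith) (hd'b.trans_le hb) hε0 hg0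
  have hmem : ∀ x : Set.Ioo a b, (x : ℝ) ∈ Set.Icc a (-1) := fun x =>
    ⟨x.2.1.le, x.2.2.le.trans hb⟩
  let q : Set.Ioo a b →ᵇ ℝ :=
    (BoundedContinuousFunction.mkOfCompact (p.toContinuousMapOn (Set.Icc a (-1)))).compContinuous
      ⟨fun x => ⟨x, hmem x⟩, by fun_prop⟩
  have hq : ∀ x : Set.Ioo a b, q x = p.eval (x : ℝ) := fun x => rfl
  refine ⟨q, hsU ?_, p, hp, hq⟩
  rw [Seminorm.mem_ball]
  refine Seminorm.finset_sup_apply_lt hr fun φ hφ => ?_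
  rw [strictSeminorm_apply]
  refine (Real.iSup_le (a := r / 2) (fun x => ?_) (by positivity)).trans_lt (by linarith)
  have hx := hpg ⟨x, hmem x⟩
  rw [BoundedContinuousFunction.sub_apply, hq, abs_mul]
  by_cases hxc : (x : ℝ) ∈ Set.Icc c d
  · rw [hgeq ⟨x, hmem x⟩ x rfl hxc] at hx
    have h1 : |φ x| ≤ |C| + 1 := by
      have h2 : |φ x| ≤ ‖φ‖ := φ.toBCF.norm_coe_le_norm x
      linarith [hC φ hφ, le_abs_self C]
    calc |φ x| * |p.eval (x : ℝ) - f x| ≤ (|C| + 1) * (r / (2 * (|C| + 1))) :=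
          mul_le_mul h1 (hx.trans (min_le_right _ _)) (abs_nonneg _) (by positivity)
      _ = r / 2 := by field_simp
  · have h1 : |p.eval (x : ℝ) - f x| ≤ 2 * ‖f‖ + 1 := by
      have h2 := hgf ⟨x, hmem x⟩
      have h3 : |f x| ≤ ‖f‖ := f.norm_coe_le_norm x
      have h4 : ε ≤ 1 := min_le_left _ _
      rw [abs_le] at *
      constructor <;> linarith
    calc |φ x| * |p.eval (x : ℝ) - f x| ≤ η * (2 * ‖f‖ + 1) :=
          mul_le_mul (hsmall φ hφ x hxc) h1 (abs_nonneg _) hη0.le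
      _ = r / 2 := by rw [hη]; field_simp
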